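/- Let $(M,\tau)$ be a tracial von Neumann algebra, i.e. a von Neumann algebra with a faithful normal tracial state, and let $M$ act on $L^2(M,\tau)$ by left multiplication; write $\hat x\in L^2(M,\tau)$ for the vector of $x\in M$. A hyperstate on $B(L^2(M,\tau))$ is a state $\varphi$ with $\varphi|_M=\tau$. For such $\varphi$, identify $L^2(M,\tau)$ with the closure of $M$ in the GNS space $L^2(B(L^2(M,\tau)),\varphi)$, let $e_M$ be the orthogonal projection onto it, put $\mathcal P_\varphi(T)=e_MTe_M\in B(L^2(M,\tau))$ for $T\in B(L^2(M,\tau))$, and let $$\mathrm{Har}(\mathcal P_\varphi)=\{T\in B(L^2(M,\tau)) : \mathcal P_\varphi(T)=T\}.$$ A normal hyperstate $\varphi$ has a standard form: there is a sequence $(z_n)$ in $M$ with $\sum_n z_n^*z_n=1$ (strongly) and $\varphi(T)=\sum_n\langle T\widehat{z_n^*},\widehat{z_n^*}\rangle$ for all $T\in B(L^2(M,\tau))$. It is called regular if, in a standard form, $\sum_n z_n^*z_n=\sum_n z_nz_n^*=1$, and strongly generating if, in a standard form, the unital algebra (not the $*$-algebra) generated by $\{z_n\}$ is weakly dense in $M$.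 Let $\varphi$ be a normal regular strongly generating hyperstate on $B(L^2(M,\tau))$. Then every $\mathcal P_\varphi$-harmonic operator commutes with the center $Z(M)$ of $M$, that is, $$\mathrm{Har}(\mathcal P_\varphi)\subset Z(M)'.$$ -/

import Mathlib

open scoped ComplexOrder

noncomputable section

namespace NCPoisson

section General

variable {A : Type*} [CStarAlgebra A] [PartialOrder A] [StarOrderedRing A]

/-- A positive linear functional is normal if it preserves the suprema of (bounded) increasing
nets. -/
def IsNormal (f : A →ₚ[ℂ] ℂ) : Prop :=
  ∀ (S : Set A) (a : A), S.Nonempty → DirectedOn (· ≤ ·) S → IsLUB S a → IsLUB (f '' S) (f a)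

/-- `τ` is a faithful normal tracial state. Together with `WStarAlgebra A` this says that `(A, τ)`
is a tracial von Neumann algebra. -/
structure IsFaithfulNormalTrace (τ : A →ₚ[ℂ] ℂ) : Prop where
  map_one : τ 1 = 1
  map_mul_comm : ∀ x y : A, τ (x * y) = τ (y * x)
  faithful : ∀ x : A, τ (star x * x) = 0 → x = 0
  normal : IsNormal τ

end General

variable {M : Type*} [CStarAlgebra M] [PartialOrder M] [StarOrderedRing M]

/-- The Hilbert space `L²(M, τ)`. -/
abbrev L2 (τ : M →ₚ[ℂ] ℂ) : Type _ := τ.GNS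

/-- The algebra `B(L²(M, τ))`. -/
abbrev BL2 (τ : M →ₚ[ℂ] ℂ) : Type _ := L2 τ →L[ℂ] L2 τ

/-- The vector `x̂ ∈ L²(M, τ)` of `x ∈ M`. -/
def hat (τ : M →ₚ[ℂ] ℂ) (x : M) : L2 τ := ((τ.toPreGNS x : τ.PreGNS) : τ.GNS)

/-- The representation of `M` on `L²(M, τ)` by left multiplication, through which `M` is seen
inside `B(L²(M, τ))`. -/
abbrev lmul (τ : M →ₚ[ℂ] ℂ) : M →⋆ₐ[ℂ] BL2 τ := τ.gnsStarAlgHom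

/-- A `τ`-hyperstate on `B(L²(M, τ))`: a positive functional which restricts to `τ` on `M`. (For
a state `τ` it is then itself a state.) -/
def IsHyperstate (τ : M →ₚ[ℂ] ℂ) (φ : BL2 τ →ₚ[ℂ] ℂ) : Prop :=
  ∀ x : M, φ (lmul τ x) = τ x

section PoissonMap

variable {τ : M →ₚ[ℂ] ℂ} {φ : BL2 τ →ₚ[ℂ] ℂ}

lemma IsHyperstate.norm_toPreGNS (h : IsHyperstate τ φ) (x : M) :
    ‖φ.toPreGNS (lmul τ x)‖ = ‖τ.toPreGNS x‖ := by
  rw [PositiveLinearMap.preGNS_norm_def, PositiveLinearMap.preGNS_norm_def,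
    PositiveLinearMap.ofPreGNS_toPreGNS, PositiveLinearMap.ofPreGNS_toPreGNS,
    ← map_star, ← map_mul, h]

/-- The isometry `L²(M, τ) → L²(B(L²(M, τ)), φ)` extending the inclusion of `M`; it identifies
`L²(M, τ)` with the closure of `M` in `L²(B(L²(M, τ)), φ)`. -/
def inclusion (h : IsHyperstate τ φ) : L2 τ →L[ℂ] φ.GNS :=
  (LinearMap.mkContinuous
    (φ.toPreGNS.toLinearMap ∘ₗ (lmul τ).toAlgHom.toLinearMap ∘ₗ τ.ofPreGNS.toLinearMap) 1
    (fun x => by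
      rw [one_mul]
      exact (h.norm_toPreGNS (τ.ofPreGNS x)).le)).completion

/-- The map `𝒫_φ(T) = e_M T e_M`, the compression to `L²(M, τ)` of the operator by which
`T ∈ B(L²(M, τ))` acts on `L²(B(L²(M, τ)), φ)`. -/
def poissonMap (h : IsHyperstate τ φ) (T : BL2 τ) : BL2 τ :=
  ContinuousLinearMap.adjoint (inclusion h) ∘L φ.gnsStarAlgHom T ∘L inclusion h

/-- The set `Har(𝒫_φ)` of harmonic operators. -/
def harmonic (h : IsHyperstate τ φ) : Set (BL2 τ) :=
  {T | poissonMap h T = T}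

end PoissonMap

/-- `z` is a sequence giving a standard form of `φ`:
`∑ zₙ* zₙ = 1` in the strong operator topology and `φ(T) = ∑ ⟨T ẑₙ*, ẑₙ*⟩` for all `T`
(Mathlib's inner product is linear in its second argument). -/
structure IsStandardForm (τ : M →ₚ[ℂ] ℂ) (φ : BL2 τ →ₚ[ℂ] ℂ) (z : ℕ → M) : Prop where
  hasSum_one : ∀ ξ : L2 τ, HasSum (fun n => lmul τ (star (z n) * z n) ξ) ξ
  hasSum_apply : ∀ T : BL2 τ,
    HasSum (fun n => inner ℂ (hat τ (star (z n))) (T (hat τ (star (z n))))) (φ T)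

/-- `φ` is regular: `∑ zₙ* zₙ = ∑ zₙ zₙ* = 1` in a standard form of `φ`. -/
def IsRegular (τ : M →ₚ[ℂ] ℂ) (φ : BL2 τ →ₚ[ℂ] ℂ) : Prop :=
  ∃ z : ℕ → M, IsStandardForm τ φ z ∧
    ∀ ξ : L2 τ, HasSum (fun n => lmul τ (z n * star (z n)) ξ) ξ

/-- `φ` is strongly generating: the unital algebra (not the `*`-algebra) generated by the `zₙ` of a
standard form of `φ` is dense in `M` for the weak operator topology of `B(L²(M, τ))`. -/
def IsStronglyGenerating (τ : M →ₚ[ℂ] ℂ) (φ : BL2 τ →ₚ[ℂ] ℂ) : Prop :=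
  ∃ z : ℕ → M, IsStandardForm τ φ z ∧
    ∀ x : M, (ContinuousLinearMapWOT.ofCLM (lmul τ x) : L2 τ →WOT[ℂ] L2 τ) ∈
      closure ((fun y : M => (ContinuousLinearMapWOT.ofCLM (lmul τ y) : L2 τ →WOT[ℂ] L2 τ)) ''
        (Algebra.adjoin ℂ (Set.range z) : Set M))

end NCPoisson

end

/-!
The proof works with the states `ψₖ = φ ∘ 𝒫_φᵏ` and with the operators `X` that are null in the
sense that `ψₖ(X* X) → 0`.

In a standard form `(zₙ)` of `φ`, the Poisson map is `𝒫_φ(X) = ∑ Rₙ* X Rₙ`, where `Rₙ ∈ M'` is right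
multiplication by `zₙ*`. If `T` is harmonic, then
`∑ (T Rₙ - Rₙ T)* (T Rₙ - Rₙ T) = 𝒫_φ(T* T) - T* T`. The sequence `ψₖ(T* T)` is increasing and
bounded, so its increments `ψₖ(𝒫_φ(T* T) - T* T)` tend to `0`, and every commutator `T Rₙ - Rₙ T` is
null (`exists_kraus`, `isNull_of_le`). Null operators form a left ideal which is stable under right
multiplication by the `Rₙ`, so `T a - a T` is null for every `a` in the unital algebra generated by
the `Rₙ` (`exists_commutant_of_mem_adjoin`); in particular `ψₖ(T a - a T) → 0`.

For a regular `φ`, every `ψₖ` restricts to the canonical trace of `M'` (`iterState_commutant`), so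
`ψₖ(T S - S T)` is at most `2 ‖T‖ ‖S 1̂‖` for `S ∈ M'`, uniformly in `k`
(`norm_iterState_commutator_le`). A central `c ∈ M` acts on `L²(M, τ)` as an element of `M'`, and
strong generation provides elements `a` as above with `‖(c - a) 1̂‖` arbitrarily small. Finally
`T c - c T` is harmonic, since `𝒫_φ` is `M`-bimodular, so `ψₖ(T c - c T) = ⟨(T c - c T) 1̂, 1̂⟩` for
all `k`. Letting first `k → ∞` and then `a → c` yields `⟨(T c - c T) 1̂, 1̂⟩ = 0`
(`inner_commutator_eq_zero`). Applied to the harmonic operators `y* T x` with `x, y ∈ M`, this says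
that all matrix coefficients of `T c - c T` between vectors of `M` vanish.
-/

open scoped ComplexOrder

noncomputable section

namespace NCPoisson

open Filter Topology

/-! ### Positive functionals and their GNS seminorms -/

section States

variable {A : Type*} [CStarAlgebra A] [PartialOrder A] [StarOrderedRing A]

/-- The Cauchy–Schwarz inequality for a positive functional. -/
lemma norm_apply_star_mul_le (ψ : A →ₚ[ℂ] ℂ) (x y : A) :
    ‖ψ (star x * y)‖ ≤ ‖ψ.toPreGNS x‖ * ‖ψ.toPreGNS y‖ :=
  norm_inner_le_norm (𝕜 := ℂ) (ψ.toPreGNS x) (ψ.toPreGNS y)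

lemma norm_toPreGNS_mul_le (ψ : A →ₚ[ℂ] ℂ) (x y : A) :
    ‖ψ.toPreGNS (x * y)‖ ≤ ‖x‖ * ‖ψ.toPreGNS y‖ := by
  have h : ‖ψ.leftMulMapPreGNS x‖ ≤ ‖x‖ := LinearMap.mkContinuous_norm_le _ (norm_nonneg _) _
  exact (ψ.leftMulMapPreGNS x).le_of_opNorm_le h (ψ.toPreGNS y)

lemma norm_toPreGNS_le (ψ : A →ₚ[ℂ] ℂ) (hψ : ψ 1 = 1) (x : A) : ‖ψ.toPreGNS x‖ ≤ ‖x‖ := by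
  have h1 : ‖ψ.toPreGNS (1 : A)‖ = 1 := by
    rw [PositiveLinearMap.preGNS_norm_def]; simp [hψ]
  simpa [h1] using norm_toPreGNS_mul_le ψ x 1

lemma norm_toPreGNS_sq (ψ : A →ₚ[ℂ] ℂ) (x : A) :
    ‖ψ.toPreGNS x‖ ^ 2 = (ψ (star x * x)).re := by
  rw [PositiveLinearMap.preGNS_norm_def, Real.sq_sqrt]
  · rfl
  · exact (Complex.le_def.1 (ψ.map_nonneg (star_mul_self_nonneg x))).1

end States

variable {M : Type*} [CStarAlgebra M] [PartialOrder M] [StarOrderedRing M]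

/-! ### The vectors `x̂` -/

section Hat

variable (τ : M →ₚ[ℂ] ℂ)

lemma lmul_hat (x y : M) : lmul τ x (hat τ y) = hat τ (x * y) := by
  simp [hat]

lemma inner_hat (x y : M) : inner ℂ (hat τ x) (hat τ y) = τ (star x * y) := by
  rw [hat, hat, UniformSpace.Completion.inner_coe]
  rfl

lemma norm_hat_sq (x : M) : ‖hat τ x‖ ^ 2 = (τ (star x * x)).re := by
  rw [hat, UniformSpace.Completion.norm_coe, norm_toPreGNS_sq]

lemma denseRange_hat : DenseRange (hat τ) :=
  UniformSpace.Completion.denseRange_coe (α := τ.PreGNS)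

lemma hat_add (x y : M) : hat τ (x + y) = hat τ x + hat τ y := by
  simp [hat, UniformSpace.Completion.coe_add]

lemma hat_sub (x y : M) : hat τ (x - y) = hat τ x - hat τ y := by
  simp [hat, UniformSpace.Completion.coe_sub]

lemma hat_smul (c : ℂ) (x : M) : hat τ (c • x) = c • hat τ x := by
  simp [hat, UniformSpace.Completion.coe_smul]

lemma lmul_hat_one (x : M) : lmul τ x (hat τ 1) = hat τ x := by
  rw [lmul_hat, mul_one]

variable {τ}

lemma hat_induction {p : L2 τ → Prop} (hp : IsClosed {ξ | p ξ}) (hhat : ∀ x : M, p (hat τ x))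
    (ξ : L2 τ) : p ξ :=
  isClosed_property (denseRange_hat τ) hp hhat ξ

lemma ext_inner_hat {S T : BL2 τ}
    (h : ∀ x y : M, inner ℂ (hat τ y) (S (hat τ x)) = inner ℂ (hat τ y) (T (hat τ x))) :
    S = T := by
  refine ContinuousLinearMap.ext fun ξ => ?_
  refine hat_induction (isClosed_eq S.continuous T.continuous) (fun x => ?_) ξ
  refine ext_inner_left ℂ fun η => ?_
  induction η using hat_induction with
  | hp => exact isClosed_eq (by fun_prop) (by fun_prop)
  | hhat y => exact h x y

end Hat

/-! ### The Poisson map -/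

section Poisson

variable {τ : M →ₚ[ℂ] ℂ} {φ : BL2 τ →ₚ[ℂ] ℂ} (h : IsHyperstate τ φ)

lemma inclusion_hat (x : M) :
    inclusion h (hat τ x) = ((φ.toPreGNS (lmul τ x) : φ.PreGNS) : φ.GNS) := by
  simp only [inclusion, hat, ContinuousLinearMap.coe_completion]
  erw [UniformSpace.Completion.map_coe (ContinuousLinearMap.uniformContinuous _)]
  rfl

lemma gns_coe (S T : BL2 τ) :
    φ.gnsStarAlgHom S ((φ.toPreGNS T : φ.PreGNS) : φ.GNS)
      = ((φ.toPreGNS (S * T) : φ.PreGNS) : φ.GNS) := by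
  simp

lemma inner_inclusion (ξ η : L2 τ) :
    inner ℂ (inclusion h ξ) (inclusion h η) = inner ℂ ξ η := by
  induction ξ, η using UniformSpace.Completion.induction_on₂ with
  | hp => apply isClosed_eq <;> fun_prop
  | ih x y =>
    change inner ℂ (inclusion h (hat τ (τ.ofPreGNS x))) (inclusion h (hat τ (τ.ofPreGNS y)))
      = inner ℂ (hat τ (τ.ofPreGNS x)) (hat τ (τ.ofPreGNS y))
    rw [inclusion_hat, inclusion_hat, UniformSpace.Completion.inner_coe,
      PositiveLinearMap.preGNS_inner_def, inner_hat]
    simp only [PositiveLinearMap.ofPreGNS_toPreGNS]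
    rw [← map_star, ← map_mul, h]

lemma inclusion_lmul (x : M) (ξ : L2 τ) :
    inclusion h (lmul τ x ξ) = φ.gnsStarAlgHom (lmul τ x) (inclusion h ξ) := by
  induction ξ using hat_induction with
  | hp => exact isClosed_eq (by fun_prop) (by fun_prop)
  | hhat y => rw [lmul_hat, inclusion_hat, inclusion_hat, gns_coe, map_mul]

lemma inner_poissonMap (T : BL2 τ) (ξ η : L2 τ) :
    inner ℂ ξ (poissonMap h T η) = inner ℂ (inclusion h ξ) (φ.gnsStarAlgHom T (inclusion h η)) := by
  rw [poissonMap, ContinuousLinearMap.comp_apply, ContinuousLinearMap.adjoint_inner_right]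
  rfl

lemma inner_poissonMap_hat (T : BL2 τ) (x y : M) :
    inner ℂ (hat τ y) (poissonMap h T (hat τ x)) = φ (star (lmul τ y) * T * lmul τ x) := by
  rw [inner_poissonMap, inclusion_hat, inclusion_hat, gns_coe, UniformSpace.Completion.inner_coe,
    PositiveLinearMap.preGNS_inner_def, mul_assoc]
  rfl

lemma apply_eq_inner (T : BL2 τ) :
    φ T = inner ℂ (hat τ 1) (poissonMap h T (hat τ 1)) := by
  rw [inner_poissonMap_hat]; simp

/-- The map `𝒫_φ`, bundled as a positive linear map. -/
def poisson : BL2 τ →ₚ[ℂ] BL2 τ :=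
  PositiveLinearMap.mk₀
    { toFun := poissonMap h
      map_add' := fun S T => by
        simp only [poissonMap, map_add, ContinuousLinearMap.add_comp, ContinuousLinearMap.comp_add]
      map_smul' := fun c T => by
        simp only [poissonMap, map_smul, ContinuousLinearMap.smul_comp,
          ContinuousLinearMap.comp_smul, RingHom.id_apply] }
    fun T hT => by
      have h1 : 0 ≤ φ.gnsStarAlgHom T := map_nonneg _ hT
      rw [ContinuousLinearMap.nonneg_iff_isPositive] at h1
      exact (ContinuousLinearMap.nonneg_iff_isPositive _).2 (h1.adjoint_conj (inclusion h))

lemma poisson_apply (T : BL2 τ) : poisson h T = poissonMap h T := rfl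

/-- `𝒫_φ` is `M`-bimodular because the inclusion into the GNS space intertwines the actions of
`M`. -/
lemma poisson_bimodule (x y : M) (T : BL2 τ) :
    poisson h (lmul τ x * T * lmul τ y) = lmul τ x * poisson h T * lmul τ y := by
  refine ContinuousLinearMap.ext fun η => ext_inner_left ℂ fun ξ => ?_
  have h1 : inner ℂ ξ ((lmul τ x * poisson h T * lmul τ y) η)
      = inner ℂ (lmul τ (star x) ξ) (poissonMap h T (lmul τ y η)) := by
    rw [map_star, ContinuousLinearMap.star_eq_adjoint, ContinuousLinearMap.adjoint_inner_left]
    rfl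
  rw [h1, poisson_apply, inner_poissonMap, inner_poissonMap, inclusion_lmul, inclusion_lmul,
    map_star, map_star, ContinuousLinearMap.star_eq_adjoint, ContinuousLinearMap.adjoint_inner_left,
    map_mul, map_mul]
  rfl

lemma poisson_one : poisson h 1 = 1 := by
  refine ContinuousLinearMap.ext fun η => ext_inner_left ℂ fun ξ => ?_
  rw [poisson_apply, inner_poissonMap, map_one]
  exact inner_inclusion h ξ η

lemma norm_gns_inclusion_sq (X : BL2 τ) (ξ : L2 τ) :
    ‖φ.gnsStarAlgHom X (inclusion h ξ)‖ ^ 2 = (inner ℂ ξ (poisson h (star X * X) ξ)).re := by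
  rw [poisson_apply, inner_poissonMap, map_mul, map_star, ← inner_self_eq_norm_sq (𝕜 := ℂ),
    mul_apply_eq_comp, ContinuousLinearMap.star_eq_adjoint,
    ContinuousLinearMap.adjoint_inner_right]; rfl

/-- For harmonic `T`, the Schwarz defect `𝒫_φ(T* T) - T* T` measures how far the inclusion of
`L²(M, τ)` into the GNS space of `φ` is from intertwining `T` with its action on the GNS space. -/
lemma norm_gns_sub_sq {T : BL2 τ} (hT : T ∈ harmonic h) (ξ : L2 τ) :
    ‖φ.gnsStarAlgHom T (inclusion h ξ) - inclusion h (T ξ)‖ ^ 2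
      = (inner ℂ ξ ((poisson h (star T * T) - star T * T) ξ)).re := by
  have hT' : poissonMap h T = T := hT
  rw [norm_sub_sq (𝕜 := ℂ)]
  have h1 : inner ℂ (φ.gnsStarAlgHom T (inclusion h ξ)) (inclusion h (T ξ))
      = inner ℂ (T ξ) (T ξ) := by
    rw [← inner_conj_symm, ← inner_poissonMap, hT', inner_conj_symm]
  have h2 : ‖inclusion h (T ξ)‖ ^ 2 = (inner ℂ (T ξ) (T ξ)).re := by
    rw [← inner_inclusion h, ← inner_self_eq_norm_sq (𝕜 := ℂ)]; rfl
  have h4 : inner ℂ ξ ((star T * T) ξ) = inner ℂ (T ξ) (T ξ) := by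
    rw [mul_apply_eq_comp, ContinuousLinearMap.star_eq_adjoint,
      ContinuousLinearMap.adjoint_inner_right]
  rw [h1, h2, norm_gns_inclusion_sq h, sub_apply, inner_sub_right, h4, Complex.sub_re]
  simp only [RCLike.re_to_complex]
  ring

lemma le_of_norm_sq_le {X Y : BL2 τ} (hY : IsSelfAdjoint Y)
    (hXY : ∀ ξ, ‖X ξ‖ ^ 2 ≤ (inner ℂ ξ (Y ξ)).re) : star X * X ≤ Y := by
  rw [ContinuousLinearMap.le_def, ContinuousLinearMap.isPositive_def']
  refine ⟨hY.sub (.star_mul_self X), fun ξ => ?_⟩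
  have h1 : inner ℂ ξ ((star X * X) ξ) = inner ℂ (X ξ) (X ξ) := by
    rw [mul_apply_eq_comp, ContinuousLinearMap.star_eq_adjoint,
      ContinuousLinearMap.adjoint_inner_right]
  have h2 : (inner ℂ (X ξ) (X ξ)).re = ‖X ξ‖ ^ 2 := by
    rw [← inner_self_eq_norm_sq (𝕜 := ℂ)]; rfl
  rw [ContinuousLinearMap.reApplyInnerSelf, inner_re_symm, sub_apply, inner_sub_right, h1, map_sub]
  simp only [RCLike.re_to_complex]
  linarith [hXY ξ]

end Poisson

variable {τ : M →ₚ[ℂ] ℂ} {φ : BL2 τ →ₚ[ℂ] ℂ} (h : IsHyperstate τ φ)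

/-! ### Right multiplications as operators in a Kraus decomposition -/

section Kraus

/-- If `φ(S* S)` dominates `‖S ζ‖²`, then `Ŝ ↦ S ζ` is a contraction from the GNS space of `φ` to
`L²(M, τ)` which intertwines the two actions of `B(L²(M, τ))`. -/
lemma exists_evaluation {ζ : L2 τ} (hζ : ∀ S : BL2 τ, ‖S ζ‖ ≤ ‖φ.toPreGNS S‖) :
    ∃ ρ : φ.GNS →L[ℂ] L2 τ, (∀ v, ‖ρ v‖ ≤ ‖v‖) ∧
      (∀ S : BL2 τ, ρ ((φ.toPreGNS S : φ.PreGNS) : φ.GNS) = S ζ) ∧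
      ∀ (S : BL2 τ) (v : φ.GNS), ρ (φ.gnsStarAlgHom S v) = S (ρ v) := by
  let f : φ.PreGNS →ₗ[ℂ] L2 τ :=
    { toFun := fun S => (φ.ofPreGNS S : BL2 τ) ζ
      map_add' := fun S T => by simp
      map_smul' := fun c S => by simp }
  let e : φ.PreGNS →ₗ[ℂ] φ.GNS := (UniformSpace.Completion.toComplL (𝕜 := ℂ)).toLinearMap
  have he : DenseRange e := UniformSpace.Completion.denseRange_coe
  have hf : ∀ S, ‖f S‖ ≤ 1 * ‖e S‖ := fun S => by
    rw [one_mul]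
    exact (hζ (φ.ofPreGNS S)).trans_eq (UniformSpace.Completion.norm_coe _).symm
  have hρ : ∀ S : BL2 τ, f.extendOfNorm e ((φ.toPreGNS S : φ.PreGNS) : φ.GNS) = S ζ := fun S =>
    f.extendOfNorm_eq he ⟨1, hf⟩ (φ.toPreGNS S)
  refine ⟨f.extendOfNorm e, fun v => ?_, hρ, fun S v => ?_⟩
  · simpa using f.norm_extendOfNorm_apply_le he 1 hf v
  · induction v using UniformSpace.Completion.induction_on with
    | hp => exact isClosed_eq (by fun_prop) (by fun_prop)
    | ih T =>
    have h1 := hρ (S * φ.ofPreGNS T)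
    rw [← gns_coe] at h1
    exact h1.trans (congrArg S (hρ (φ.ofPreGNS T)).symm)

/-- The operator `R` is right multiplication by `zₙ*`. As `𝒫_φ(X) = ∑ Rₙ* X Rₙ` and
`∑ (T Rₙ - Rₙ T)* (T Rₙ - Rₙ T) = 𝒫_φ(T* T) - T* T` for harmonic `T`, both inequalities drop all
terms but one from a sum of positive operators. Their proof avoids these operator sums: `R` is the
inclusion of `L²(M, τ)` into the GNS space of `φ`, followed by evaluation at the vector of `zₙ*`. -/
lemma exists_kraus {z : ℕ → M} (hz : IsStandardForm τ φ z) (n : ℕ) :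
    ∃ R : BL2 τ, (∀ x, R * lmul τ x = lmul τ x * R) ∧ R (hat τ 1) = hat τ (star (z n)) ∧
      (∀ X, star (X * R) * (X * R) ≤ poisson h (star X * X)) ∧
      ∀ T ∈ harmonic h, star (T * R - R * T) * (T * R - R * T)
        ≤ poisson h (star T * T) - star T * T := by
  have hζ : ∀ S : BL2 τ, ‖S (hat τ (star (z n)))‖ ≤ ‖φ.toPreGNS S‖ := fun S => by
    rw [← sq_le_sq₀ (norm_nonneg _) (norm_nonneg _), norm_toPreGNS_sq]
    have h0 := Complex.hasSum_re (hz.hasSum_apply (star S * S))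
    have h1 : ∀ m, (inner ℂ (hat τ (star (z m))) ((star S * S) (hat τ (star (z m))))).re
        = ‖S (hat τ (star (z m)))‖ ^ 2 := fun m => by
      rw [mul_apply_eq_comp, ContinuousLinearMap.star_eq_adjoint,
        ContinuousLinearMap.adjoint_inner_right, ← inner_self_eq_norm_sq (𝕜 := ℂ)]
      rfl
    simp only [h1] at h0
    exact le_hasSum h0 n fun m _ => sq_nonneg _
  obtain ⟨ρ, hρ, hρhat, hρmul⟩ := exists_evaluation hζ
  refine ⟨ρ ∘L inclusion h, fun x => ?_, ?_, fun X => ?_, fun T hT => ?_⟩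
  · refine ContinuousLinearMap.ext fun ξ => ?_
    simp only [mul_apply_eq_comp, ContinuousLinearMap.comp_apply]
    rw [inclusion_lmul, hρmul]
  · rw [ContinuousLinearMap.comp_apply, inclusion_hat, hρhat, map_one, one_apply_eq_self]
  · refine le_of_norm_sq_le ((IsSelfAdjoint.star_mul_self X).map' _) fun ξ => ?_
    rw [← norm_gns_inclusion_sq, sq_le_sq₀ (norm_nonneg _) (norm_nonneg _)]
    have : (X * (ρ ∘L inclusion h)) ξ = ρ (φ.gnsStarAlgHom X (inclusion h ξ)) := by
      rw [hρmul]; rfl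
    rw [this]
    exact hρ _
  · refine le_of_norm_sq_le (((IsSelfAdjoint.star_mul_self T).map' _).sub
      (.star_mul_self T)) fun ξ => ?_
    rw [← norm_gns_sub_sq h hT, sq_le_sq₀ (norm_nonneg _) (norm_nonneg _)]
    have : (T * (ρ ∘L inclusion h) - (ρ ∘L inclusion h) * T) ξ
        = ρ (φ.gnsStarAlgHom T (inclusion h ξ) - inclusion h (T ξ)) := by
      rw [map_sub, hρmul]; rfl
    rw [this]
    exact hρ _

end Kraus

/-! ### Operators that vanish along the iterates of the Poisson map -/

section Null

/-- The state `φ ∘ 𝒫_φᵏ`. -/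
def iterState : ℕ → (BL2 τ →ₚ[ℂ] ℂ)
  | 0 => φ
  | k + 1 => (iterState k).comp (poisson h)

lemma iterState_succ (k : ℕ) (T : BL2 τ) :
    iterState h (k + 1) T = iterState h k (poisson h T) := rfl

lemma iterState_one (hτ : τ 1 = 1) (k : ℕ) : iterState h k 1 = 1 := by
  induction k with
  | zero =>
    have h1 := h 1
    rw [map_one, hτ] at h1
    exact h1
  | succ k ih => rw [iterState_succ, poisson_one, ih]

lemma iterState_harmonic {T : BL2 τ} (hT : T ∈ harmonic h) (k : ℕ) :
    iterState h k T = inner ℂ (hat τ 1) (T (hat τ 1)) := by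
  have hT' : poissonMap h T = T := hT
  induction k with
  | zero => exact (apply_eq_inner h T).trans (by rw [hT'])
  | succ k ih => rw [iterState_succ, poisson_apply, hT', ih]

/-- `X` is null if `φ(𝒫_φᵏ(X* X)) → 0` as `k → ∞`. The definition uses the square root of this
number, a seminorm in `X`. -/
def IsNull (X : BL2 τ) : Prop :=
  Tendsto (fun k => ‖(iterState h k).toPreGNS X‖) atTop (𝓝 0)

variable {h}

lemma IsNull.add {X Y : BL2 τ} (hX : IsNull h X) (hY : IsNull h Y) : IsNull h (X + Y) :=
  squeeze_zero (fun _ => norm_nonneg _)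
    (fun k => (congrArg norm (map_add _ X Y)).trans_le (norm_add_le _ _))
    (by rw [← add_zero (0 : ℝ)]; exact Tendsto.add hX hY)

lemma IsNull.mul_left {X : BL2 τ} (hX : IsNull h X) (S : BL2 τ) : IsNull h (S * X) :=
  squeeze_zero (fun _ => norm_nonneg _)
    (fun k => norm_toPreGNS_mul_le _ S X) (by rw [← mul_zero ‖S‖]; exact Tendsto.const_mul ‖S‖ hX)

lemma isNull_zero : IsNull h 0 := by simp [IsNull]

lemma IsNull.mul_right {X R : BL2 τ} (hX : IsNull h X)
    (hR : ∀ X, star (X * R) * (X * R) ≤ poisson h (star X * X)) : IsNull h (X * R) := by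
  refine squeeze_zero (fun _ => norm_nonneg _) (fun k => ?_) ((tendsto_add_atTop_iff_nat 1).2 hX)
  rw [← sq_le_sq₀ (norm_nonneg _) (norm_nonneg _), norm_toPreGNS_sq, norm_toPreGNS_sq]
  exact (Complex.le_def.1 (OrderHomClass.mono (iterState h k) (hR X))).1

/-- The numbers `φ(𝒫_φᵏ(T* T))` increase with `k` if `𝒫_φ(T* T) - T* T` dominates a positive
operator, and they are bounded by `‖T‖²`; hence their increments tend to `0`. -/
lemma isNull_of_le {T X : BL2 τ} (hτ : τ 1 = 1)
    (hX : star X * X ≤ poisson h (star T * T) - star T * T) : IsNull h X := by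
  set t : ℕ → ℝ := fun k => ((iterState h k) (star T * T)).re with ht
  have hle : ∀ k, ‖(iterState h k).toPreGNS X‖ ^ 2 ≤ t (k + 1) - t k := fun k => by
    rw [norm_toPreGNS_sq]
    have := (Complex.le_def.1 (OrderHomClass.mono (iterState h k) hX)).1
    rwa [map_sub, Complex.sub_re] at this
  have hmono : Monotone t := monotone_nat_of_le_succ fun k => by
    linarith [hle k, sq_nonneg ‖(iterState h k).toPreGNS X‖]
  have hbdd : BddAbove (Set.range t) := by
    refine ⟨‖T‖ ^ 2, ?_⟩
    rintro _ ⟨k, rfl⟩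
    simp only [ht]
    rw [← norm_toPreGNS_sq, sq_le_sq₀ (norm_nonneg _) (norm_nonneg _)]
    exact norm_toPreGNS_le _ (iterState_one h hτ k) T
  have hlim := tendsto_atTop_ciSup hmono hbdd
  have h0 : Tendsto (fun k => t (k + 1) - t k) atTop (𝓝 0) := by
    simpa using ((tendsto_add_atTop_iff_nat 1).2 hlim).sub hlim
  have h1 : Tendsto (fun k => ‖(iterState h k).toPreGNS X‖ ^ 2) atTop (𝓝 0) :=
    squeeze_zero (fun _ => sq_nonneg _) hle h0
  simpa [IsNull, Real.sqrt_sq (norm_nonneg _)] using h1.sqrt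

lemma IsNull.tendsto_iterState {X : BL2 τ} (hτ : τ 1 = 1) (hX : IsNull h X) :
    Tendsto (fun k => iterState h k X) atTop (𝓝 0) := by
  refine squeeze_zero_norm (fun k => ?_) hX
  have h1 := norm_apply_star_mul_le (iterState h k) 1 X
  have h2 := norm_toPreGNS_le _ (iterState_one h hτ k) (1 : BL2 τ)
  rw [star_one, one_mul] at h1
  refine h1.trans (mul_le_of_le_one_left (norm_nonneg _) (h2.trans ?_))
  exact ContinuousLinearMap.norm_id_le

variable (h)

/-- For `y` in the algebra generated by the `zₙ`, right multiplication by `y*` commutes modulo null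
operators with every harmonic operator: the null operators absorb left multiplication by everything
and right multiplication by the generators, so this passes from generators to products. -/
lemma exists_commutant_of_mem_adjoin (hτ : τ 1 = 1) {z : ℕ → M} (hz : IsStandardForm τ φ z) {y : M}
    (hy : y ∈ Algebra.adjoin ℂ (Set.range z)) :
    ∃ a : BL2 τ, (∀ x, a * lmul τ x = lmul τ x * a) ∧ a (hat τ 1) = hat τ (star y) ∧
      (∀ X, IsNull h X → IsNull h (X * a)) ∧ ∀ T ∈ harmonic h, IsNull h (T * a - a * T) := by
  induction hy using Algebra.adjoin_induction with
  | mem y hy =>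
    obtain ⟨n, rfl⟩ := hy
    obtain ⟨R, h1, h2, h3, h4⟩ := exists_kraus h hz n
    exact ⟨R, h1, h2, fun X hX => hX.mul_right h3, fun T hT => isNull_of_le hτ (h4 T hT)⟩
  | algebraMap r =>
    refine ⟨star r • 1, fun x => by simp, ?_, fun X hX => ?_, fun T hT => ?_⟩
    · rw [Algebra.algebraMap_eq_smul_one, star_smul, star_one, hat_smul, smul_apply,
        one_apply_eq_self]
    · simpa using hX.mul_left (star r • 1)
    · simpa using isNull_zero
  | add y₁ y₂ _ _ ih₁ ih₂ =>
    obtain ⟨a, a1, a2, a3, a4⟩ := ih₁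
    obtain ⟨b, b1, b2, b3, b4⟩ := ih₂
    refine ⟨a + b, fun x => by rw [add_mul, mul_add, a1, b1], ?_, fun X hX => ?_, fun T hT => ?_⟩
    · rw [add_apply, a2, b2, star_add, hat_add]
    · rw [mul_add]; exact (a3 X hX).add (b3 X hX)
    · rw [show T * (a + b) - (a + b) * T = (T * a - a * T) + (T * b - b * T) by noncomm_ring]
      exact (a4 T hT).add (b4 T hT)
  | mul y₁ y₂ _ _ ih₁ ih₂ =>
    obtain ⟨a, a1, a2, a3, a4⟩ := ih₁
    obtain ⟨b, b1, b2, b3, b4⟩ := ih₂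
    refine ⟨a * b, fun x => by rw [mul_assoc, b1, ← mul_assoc, a1, mul_assoc], ?_, fun X hX => ?_,
      fun T hT => ?_⟩
    · rw [mul_apply_eq_comp, b2, ← lmul_hat_one, ← mul_apply_eq_comp, a1, mul_apply_eq_comp, a2,
        lmul_hat, star_mul]
    · rw [← mul_assoc]; exact b3 _ (a3 X hX)
    · rw [show T * (a * b) - (a * b) * T = (T * a - a * T) * b + a * (T * b - b * T) by
        noncomm_ring]
      exact (b3 _ (a4 T hT)).add ((b4 T hT).mul_left a)

end Null

/-! ### The iterated states on the commutant -/

section Commutant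

/-- On the commutant of `M` a regular hyperstate is the vector state of `1̂`; this is where
`∑ zₙ zₙ* = 1` enters. -/
lemma apply_commutant {z : ℕ → M} (hz : IsStandardForm τ φ z)
    (hreg : ∀ ξ : L2 τ, HasSum (fun n => lmul τ (z n * star (z n)) ξ) ξ) {S : BL2 τ}
    (hS : ∀ x, S * lmul τ x = lmul τ x * S) : φ S = inner ℂ (hat τ 1) (S (hat τ 1)) := by
  refine (hz.hasSum_apply S).unique ?_
  refine ((hreg (S (hat τ 1))).mapL (innerSL ℂ (hat τ 1))).congr_fun fun n => ?_
  rw [innerSL_apply_apply, ← lmul_hat_one τ (star (z n)), ← mul_apply_eq_comp, hS,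
    mul_apply_eq_comp, map_mul, mul_apply_eq_comp, map_star, ContinuousLinearMap.star_eq_adjoint,
    ContinuousLinearMap.adjoint_inner_left]

lemma iterState_commutant {z : ℕ → M} (hz : IsStandardForm τ φ z)
    (hreg : ∀ ξ : L2 τ, HasSum (fun n => lmul τ (z n * star (z n)) ξ) ξ) (k : ℕ) {S : BL2 τ}
    (hS : ∀ x, S * lmul τ x = lmul τ x * S) :
    iterState h k S = inner ℂ (hat τ 1) (S (hat τ 1)) := by
  induction k generalizing S with
  | zero => exact apply_commutant hz hreg hS
  | succ k ih =>
    rw [iterState_succ, ih, poisson_apply, ← apply_eq_inner, apply_commutant hz hreg hS]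
    intro x
    have h1 := poisson_bimodule h 1 x S
    have h2 := poisson_bimodule h x 1 S
    simp only [map_one, one_mul, mul_one] at h1 h2
    rw [← h1, ← h2, hS]

lemma star_commutant {S : BL2 τ} (hS : ∀ x, S * lmul τ x = lmul τ x * S) (x : M) :
    star S * lmul τ x = lmul τ x * star S := by
  have := congrArg star (hS (star x))
  rw [star_mul, star_mul, map_star, star_star] at this
  exact this.symm

/-- An operator of `M'` that maps `1̂` to `d̂` acts as right multiplication by `d`, and its adjoint
as right multiplication by `d*`. -/
lemma star_apply_hat_one (hτ : ∀ x y : M, τ (x * y) = τ (y * x)) {S : BL2 τ}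
    (hS : ∀ x, S * lmul τ x = lmul τ x * S) {d : M} (hd : S (hat τ 1) = hat τ d) :
    star S (hat τ 1) = hat τ (star d) := by
  refine ext_inner_left ℂ fun ξ => ?_
  induction ξ using hat_induction with
  | hp => exact isClosed_eq (by fun_prop) (by fun_prop)
  | hhat x =>
    rw [ContinuousLinearMap.star_eq_adjoint, ContinuousLinearMap.adjoint_inner_right,
      ← lmul_hat_one τ x, ← mul_apply_eq_comp, hS, mul_apply_eq_comp, hd, lmul_hat, lmul_hat_one,
      inner_hat, inner_hat, star_mul, mul_one, hτ]

lemma norm_hat_star (hτ : ∀ x y : M, τ (x * y) = τ (y * x)) (d : M) :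
    ‖hat τ (star d)‖ = ‖hat τ d‖ := by
  rw [← sq_eq_sq₀ (norm_nonneg _) (norm_nonneg _), norm_hat_sq, norm_hat_sq, star_star, hτ]

lemma norm_toPreGNS_commutant {z : ℕ → M} (hz : IsStandardForm τ φ z)
    (hreg : ∀ ξ : L2 τ, HasSum (fun n => lmul τ (z n * star (z n)) ξ) ξ) (k : ℕ) {S : BL2 τ}
    (hS : ∀ x, S * lmul τ x = lmul τ x * S) :
    ‖(iterState h k).toPreGNS S‖ = ‖S (hat τ 1)‖ := by
  rw [← sq_eq_sq₀ (norm_nonneg _) (norm_nonneg _), norm_toPreGNS_sq,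
    iterState_commutant h hz hreg k (S := star S * S), mul_apply_eq_comp,
    ContinuousLinearMap.star_eq_adjoint, ContinuousLinearMap.adjoint_inner_right,
    ← inner_self_eq_norm_sq (𝕜 := ℂ)]
  · rfl
  · intro x
    rw [mul_assoc, hS, ← mul_assoc, star_commutant hS, mul_assoc]

/-- The bound does not depend on `k`, because on `M'` all iterated states are the same trace. -/
lemma norm_iterState_commutator_le (hτ : IsFaithfulNormalTrace τ) {z : ℕ → M}
    (hz : IsStandardForm τ φ z)
    (hreg : ∀ ξ : L2 τ, HasSum (fun n => lmul τ (z n * star (z n)) ξ) ξ) (k : ℕ) {S : BL2 τ}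
    (hS : ∀ x, S * lmul τ x = lmul τ x * S) {d : M} (hd : S (hat τ 1) = hat τ d) (T : BL2 τ) :
    ‖iterState h k (T * S - S * T)‖ ≤ 2 * ‖T‖ * ‖hat τ d‖ := by
  have hone := iterState_one h hτ.map_one k
  have h1 : ‖iterState h k (T * S)‖ ≤ ‖T‖ * ‖hat τ d‖ := by
    have := norm_apply_star_mul_le (iterState h k) (star T) S
    rw [star_star, norm_toPreGNS_commutant h hz hreg k hS, hd] at this
    refine this.trans (mul_le_mul_of_nonneg_right ?_ (norm_nonneg _))
    exact (norm_toPreGNS_le _ hone _).trans_eq (norm_star T)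
  have h2 : ‖iterState h k (S * T)‖ ≤ ‖hat τ d‖ * ‖T‖ := by
    have := norm_apply_star_mul_le (iterState h k) (star S) T
    rw [star_star, norm_toPreGNS_commutant h hz hreg k (star_commutant hS),
      star_apply_hat_one hτ.map_mul_comm hS hd, norm_hat_star hτ.map_mul_comm] at this
    exact this.trans (mul_le_mul_of_nonneg_left (norm_toPreGNS_le _ hone _) (norm_nonneg _))
  rw [map_sub]
  linarith [norm_sub_le (iterState h k (T * S)) (iterState h k (S * T))]

end Commutant

/-! ### Commutation with the center -/

/-- Weak operator density gives density in `L²(M, τ)`: the weak and the norm closure of a subspace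
of a Hilbert space agree. -/
lemma hat_mem_closure (A : Subalgebra ℂ M) {x : M}
    (hx : (ContinuousLinearMapWOT.ofCLM (lmul τ x) : L2 τ →WOT[ℂ] L2 τ) ∈
      closure ((fun y : M => (ContinuousLinearMapWOT.ofCLM (lmul τ y) : L2 τ →WOT[ℂ] L2 τ)) ''
        (A : Set M))) :
    hat τ x ∈ closure (hat τ '' (A : Set M)) := by
  let L : M →ₗ[ℂ] L2 τ :=
    { toFun := hat τ, map_add' := hat_add τ, map_smul' := hat_smul τ }
  let K : Submodule ℂ (L2 τ) := (Subalgebra.toSubmodule A).map L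
  have hK : (K : Set (L2 τ)) = hat τ '' (A : Set M) := rfl
  rw [← hK, ← Submodule.topologicalClosure_coe, SetLike.mem_coe,
    ← Submodule.orthogonal_orthogonal_eq_closure]
  intro η hη
  have hcl : IsClosed {S : L2 τ →WOT[ℂ] L2 τ | inner ℂ η (S (hat τ 1)) = 0} := by
    refine isClosed_eq ?_ continuous_const
    exact ContinuousLinearMapWOT.continuous_dual_apply (hat τ 1) (innerSL ℂ η)
  have h1 := closure_minimal ?_ hcl hx
  · rw [← lmul_hat_one]; exact h1
  · rintro _ ⟨y, hy, rfl⟩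
    have : hat τ y ∈ K := ⟨y, hy, rfl⟩
    have h2 := Submodule.inner_left_of_mem_orthogonal this hη
    rw [← lmul_hat_one] at h2
    exact h2

/-- The commutator of a harmonic `T` with a central `c` is harmonic, so the states `φ ∘ 𝒫_φᵏ` all
take the same value on it. Replacing `c` by an approximating right multiplication `a` changes that
value little, uniformly in `k`, and on the commutator of `T` with `a` the values tend to `0`. -/
lemma inner_commutator_eq_zero (hτ : IsFaithfulNormalTrace τ) (hreg : IsRegular τ φ)
    (hgen : IsStronglyGenerating τ φ) {c : M} (hc : c ∈ Set.center M) {T : BL2 τ}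
    (hT : T ∈ harmonic h) :
    inner ℂ (hat τ 1) ((T * lmul τ c - lmul τ c * T) (hat τ 1)) = 0 := by
  -- Regularity and generation may be witnessed by different standard forms.
  obtain ⟨w, hw, hwreg⟩ := hreg
  obtain ⟨z, hz, hzgen⟩ := hgen
  have hccomm : ∀ x, lmul τ c * lmul τ x = lmul τ x * lmul τ c := fun x => by
    rw [← map_mul, ← map_mul, (hc.comm x).eq]
  have hharm : T * lmul τ c - lmul τ c * T ∈ harmonic h := by
    have hT' : poisson h T = T := hT
    have h1 := poisson_bimodule h 1 c T
    have h2 := poisson_bimodule h c 1 T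
    simp only [map_one, one_mul, mul_one, hT'] at h1 h2
    change poisson h _ = _
    rw [map_sub, h1, h2]
  have key : ∀ ε > 0, ‖inner ℂ (hat τ 1) ((T * lmul τ c - lmul τ c * T) (hat τ 1))‖
      ≤ 2 * ‖T‖ * ε := by
    intro ε hε
    -- `y` approximates `star c` since its partner `a` is right multiplication by `star y`.
    obtain ⟨_, ⟨y, hy, rfl⟩, hyε⟩ :=
      Metric.mem_closure_iff.1 (hat_mem_closure _ (hzgen (star c))) ε hε
    obtain ⟨a, a1, a2, -, a4⟩ := exists_commutant_of_mem_adjoin h hτ.map_one hz hy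
    have hd : (lmul τ c - a) (hat τ 1) = hat τ (c - star y) := by
      rw [sub_apply, a2, lmul_hat_one, hat_sub]
    have hdε : ‖hat τ (c - star y)‖ ≤ ε := by
      rw [dist_eq_norm, ← hat_sub, ← norm_hat_star hτ.map_mul_comm, star_sub, star_star] at hyε
      exact hyε.le
    have hlim : Tendsto (fun k => iterState h k (T * lmul τ c - lmul τ c * T)
        - iterState h k (T * a - a * T)) atTop
        (𝓝 (inner ℂ (hat τ 1) ((T * lmul τ c - lmul τ c * T) (hat τ 1)) - 0)) := by
      refine Tendsto.sub ?_ ((a4 T hT).tendsto_iterState hτ.map_one)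
      simp only [iterState_harmonic h hharm]
      exact tendsto_const_nhds
    rw [sub_zero] at hlim
    refine le_of_tendsto hlim.norm (Eventually.of_forall fun k => ?_)
    rw [← map_sub, show T * lmul τ c - lmul τ c * T - (T * a - a * T)
      = T * (lmul τ c - a) - (lmul τ c - a) * T by noncomm_ring]
    refine (norm_iterState_commutator_le h hτ hw hwreg k (fun x => ?_) hd T).trans ?_
    · rw [sub_mul, mul_sub, hccomm, a1]
    · gcongr
  have hlim : Tendsto (fun ε : ℝ => 2 * ‖T‖ * ε) (𝓝[>] 0) (𝓝 0) := by
    have : Tendsto (fun ε : ℝ => 2 * ‖T‖ * ε) (𝓝 0) (𝓝 (2 * ‖T‖ * 0)) :=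
      (continuous_const.mul continuous_id).tendsto 0
    rw [mul_zero] at this
    exact this.mono_left nhdsWithin_le_nhds
  exact norm_le_zero_iff.1 (ge_of_tendsto hlim (eventually_mem_nhdsWithin.mono key))

end NCPoisson

end

theorem mainTheorem12 {M : Type*} [CStarAlgebra M] [PartialOrder M] [StarOrderedRing M]
    [WStarAlgebra M] (τ : M →ₚ[ℂ] ℂ) (hτ : NCPoisson.IsFaithfulNormalTrace τ)
    (φ : NCPoisson.BL2 τ →ₚ[ℂ] ℂ) (hφ : NCPoisson.IsHyperstate τ φ)
    (hnormal : NCPoisson.IsNormal φ)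
    (hregular : NCPoisson.IsRegular τ φ)
    (hgen : NCPoisson.IsStronglyGenerating τ φ) :
    NCPoisson.harmonic hφ ⊆
      Set.centralizer (NCPoisson.lmul τ '' (Set.center M)) := by
  rintro T hT _ ⟨c, hc, rfl⟩
  refine NCPoisson.ext_inner_hat fun x y => ?_
  -- Compressing by `lmul τ (star y)` and `lmul τ x` reduces the claim to the vector `1̂`.
  have hT' : NCPoisson.poisson hφ T = T := hT
  have hharm : NCPoisson.lmul τ (star y) * T * NCPoisson.lmul τ x ∈ NCPoisson.harmonic hφ := by
    change NCPoisson.poisson hφ _ = _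
    rw [NCPoisson.poisson_bimodule, hT']
  have h1 := NCPoisson.inner_commutator_eq_zero hφ hτ hregular hgen hc hharm
  have hx : NCPoisson.lmul τ x * NCPoisson.lmul τ c = NCPoisson.lmul τ c * NCPoisson.lmul τ x := by
    rw [← map_mul, ← map_mul, (hc.comm x).eq]
  have hy : NCPoisson.lmul τ c * NCPoisson.lmul τ (star y)
      = NCPoisson.lmul τ (star y) * NCPoisson.lmul τ c := by
    rw [← map_mul, ← map_mul, (hc.comm (star y)).eq]
  have hcomm : NCPoisson.lmul τ (star y) * T * NCPoisson.lmul τ x * NCPoisson.lmul τ c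
        - NCPoisson.lmul τ c * (NCPoisson.lmul τ (star y) * T * NCPoisson.lmul τ x)
      = NCPoisson.lmul τ (star y) * ((T * NCPoisson.lmul τ c - NCPoisson.lmul τ c * T)
        * NCPoisson.lmul τ x) := by
    rw [mul_assoc _ (NCPoisson.lmul τ x), hx, ← mul_assoc (NCPoisson.lmul τ c),
      ← mul_assoc (NCPoisson.lmul τ c), hy]
    noncomm_ring
  rw [hcomm, mul_apply_eq_comp, mul_apply_eq_comp,
    NCPoisson.lmul_hat_one, map_star, ContinuousLinearMap.star_eq_adjoint,
    ContinuousLinearMap.adjoint_inner_right, NCPoisson.lmul_hat_one, sub_apply, inner_sub_right,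
    sub_eq_zero] at h1
  exact h1.symm
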